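/- Let $F$ be a skew field, $\sigma$ an automorphism of $F$ and $\delta$ a $\sigma$-derivation of $F$ (additive, with $\delta(ab)=\sigma(a)\delta(b)+\delta(a)b$), and let $R=F[\partial;\sigma,\delta]$ be the ring of Ore polynomials $\sum_k a_k\partial^k$ ($a_k\in F$), with multiplication determined by $\partial a=\sigma(a)\partial+\delta(a)$. Let $\deg$ be the degree in $\partial$, with $\deg 0=-\infty$, and for $f\in R$ let $f_k$ be the coefficient of $\partial^k$ in $f$. Let $A\in R^{n\times n}$ have full rank, i.e. the left $R$-module generated by its rows has rank $n$, and suppose $\deg A_{ij}\le d$ for all $i,j$, where $d\in\mathbb N$. A square matrix $H\in R^{n\times n}$ of full rank is in Hermite form if it is upper triangular with monic diagonal entries and $\deg H_{ij}<\deg H_{jj}$ for $i<j$. Then $A$ has a unique Hermite form, that is, there is exactly one $H$ in Hermite form with $H=UA$ for some unimodular $U\in R^{n\times n}$ (i.e. $U$ is invertible over $R$). Let $h_i=\deg H_{ii}$. Let $d_1,\dots,d_n$ be non-negative integers and let $\varrho\ge 0$ be an integer with $\varrho\ge (n-1)d+\max_i(d_i-h_i)$. Let $T$ be the $n\times n$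 matrix with entries $T_{ij}=\sum_{0\le k\le\varrho}t_{ijk}\partial^k$, with unknowns $t_{ijk}$, and consider the system of linear equations in the $t_{ijk}$ \[ \begin{aligned} ((TA)_{ii})_{d_i}&=1 && (1\le i\le n),\\ ((TA)_{ii})_{k}&=0 && (1\le i\le n,\ k>d_i),\\ ((TA)_{ij})_{k}&=0 && (i\ne j,\ k\ge d_j). \end{aligned} \] A solution is an assignment of values in $F$ to the unknowns $t_{ijk}$ for which all these equations hold. Then: (i) if $d_i\ge h_i$ for all $i$, then the system has a solution; (ii) if there is an index $\ell$ such that $d_i=h_i$ for all $i<\ell$ and $d_\ell<h_\ell$, then the system has no solution; (iii) if $d_i=h_i$ for all $i$, then the system has exactly one solution, and for that solution $TA=H$, the Hermite form of $A$. -/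

import Mathlib

universe u

/-- A `σ`-derivation of a skew field `F`: an additive map `δ` with
`δ (a * b) = σ a * δ b + δ a * b`. -/
structure SigmaDerivation {F : Type u} [DivisionRing F] (σ : F ≃+* F) extends F →+ F where
  leibniz' : ∀ a b : F, toFun (a * b) = σ a * toFun b + toFun a * b

/-- The Ore polynomials `F[∂; σ, δ]`. The underlying additive group is that of the usual
polynomials over `F` (coefficients on the left); the multiplication, defined below, is
the one determined by `∂ a = σ(a) ∂ + δ(a)`. -/
def OrePoly {F : Type u} [DivisionRing F] (σ : F ≃+* F) (_δ : SigmaDerivation σ) : Type u :=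
  Polynomial F

namespace OrePoly

open Polynomial

variable {F : Type u} [DivisionRing F] (σ : F ≃+* F) (δ : SigmaDerivation σ)

/-- Left multiplication by `∂`, namely `∑ bⱼ ∂ʲ ↦ ∑ (σ(bⱼ) ∂ʲ⁺¹ + δ(bⱼ) ∂ʲ)`. -/
noncomputable def dMul : AddMonoid.End F[X] where
  toFun p := p.sum fun j b => monomial (j + 1) (σ b) + monomial j (δ.toAddMonoidHom b)
  map_zero' := by simp
  map_add' p q := by
    apply Polynomial.sum_add_index
    · intro i; simp
    · intro i a b; simp only [map_add]; abel

/-- The product `(∑ aᵢ ∂ⁱ) q = ∑ aᵢ (∂ⁱ q)`. -/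
noncomputable def mulFun (p q : F[X]) : F[X] :=
  p.sum fun i a => a • (dMul σ δ)^[i] q

/-- Left multiplication by `p`, as an additive endomorphism. -/
noncomputable def mulLeftHom : F[X] →+ AddMonoid.End F[X] where
  toFun p := p.sum fun i a => Module.toAddMonoidEnd F F[X] a * dMul σ δ ^ i
  map_zero' := by simp
  map_add' p q := by
    apply Polynomial.sum_add_index
    · intro i; simp
    · intro i a b; simp only [map_add, add_mul]

theorem mulLeftHom_monomial (i : ℕ) (a : F) :
    mulLeftHom σ δ (monomial i a) =
      Module.toAddMonoidEnd F F[X] a * dMul σ δ ^ i := by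
  change (monomial i a).sum
    (fun i a => Module.toAddMonoidEnd F F[X] a * dMul σ δ ^ i) = _
  rw [Polynomial.sum_monomial_index]
  simp

theorem end_mul_apply (f g : AddMonoid.End F[X]) (p : F[X]) : (f * g) p = f (g p) := rfl

theorem end_add_apply (f g : AddMonoid.End F[X]) (p : F[X]) : (f + g) p = f p + g p := rfl

theorem mulFun_eq (p q : F[X]) : mulFun σ δ p q = mulLeftHom σ δ p q := by
  change Polynomial.sum p _ = (Polynomial.sum p _ : AddMonoid.End F[X]) q
  simp only [Polynomial.sum]
  erw [AddMonoidHom.finsetSum_apply]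
  refine Finset.sum_congr rfl fun i _ => ?_
  change _ = p.coeff i • (dMul σ δ ^ i : AddMonoid.End F[X]) q
  rw [AddMonoid.End.coe_pow]

theorem dMul_monomial (j : ℕ) (b : F) :
    dMul σ δ (monomial j b) = monomial (j + 1) (σ b) + monomial j (δ.toAddMonoidHom b) := by
  change (monomial j b).sum
    (fun j b => monomial (j + 1) (σ b) + monomial j (δ.toAddMonoidHom b)) = _
  rw [Polynomial.sum_monomial_index]
  simp

theorem dMul_smul (a : F) (p : F[X]) :
    dMul σ δ (a • p) = σ a • dMul σ δ p + δ.toAddMonoidHom a • p := by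
  induction p using Polynomial.induction_on' with
  | add p q hp hq => simp only [smul_add, map_add, hp, hq]; abel
  | monomial n b =>
    have h : δ.toAddMonoidHom (a * b) = σ a * δ.toAddMonoidHom b + δ.toAddMonoidHom a * b :=
      δ.leibniz' a b
    simp only [smul_monomial, smul_eq_mul, dMul_monomial, smul_add, h, map_mul, map_add]
    abel

theorem mulLeftHom_smul (a : F) (p : F[X]) :
    mulLeftHom σ δ (a • p) = Module.toAddMonoidEnd F F[X] a * mulLeftHom σ δ p := by
  induction p using Polynomial.induction_on' with
  | add p q hp hq => simp only [smul_add, map_add, hp, hq, mul_add]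
  | monomial n b =>
    simp only [smul_monomial, smul_eq_mul, mulLeftHom_monomial, map_mul, mul_assoc]

theorem mulLeftHom_dMul (p : F[X]) :
    mulLeftHom σ δ (dMul σ δ p) = dMul σ δ * mulLeftHom σ δ p := by
  induction p using Polynomial.induction_on' with
  | add p q hp hq => simp only [map_add, hp, hq, mul_add]
  | monomial n b =>
    rw [dMul_monomial, map_add, mulLeftHom_monomial, mulLeftHom_monomial, mulLeftHom_monomial,
      pow_succ', ← mul_assoc, ← mul_assoc, ← add_mul]
    congr 1
    ext1 q
    exact (dMul_smul σ δ b q).symm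

theorem mulLeftHom_mul (p q : F[X]) :
    mulLeftHom σ δ (mulLeftHom σ δ p q) = mulLeftHom σ δ p * mulLeftHom σ δ q := by
  induction p using Polynomial.induction_on' with
  | add p p' hp hq => simp only [map_add, end_add_apply, add_mul, hp, hq]
  | monomial n b =>
    have key : ∀ n : ℕ, mulLeftHom σ δ ((dMul σ δ ^ n) q) =
        dMul σ δ ^ n * mulLeftHom σ δ q := by
      intro n
      induction n with
      | zero => simp
      | succ n ih => rw [pow_succ', end_mul_apply, mulLeftHom_dMul, ih, mul_assoc]
    rw [mulLeftHom_monomial, mul_assoc, ← key, ← mulLeftHom_smul]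
    rfl

noncomputable instance : AddCommGroup (OrePoly σ δ) := inferInstanceAs (AddCommGroup F[X])

noncomputable instance : Mul (OrePoly σ δ) := ⟨mulFun σ δ⟩

noncomputable instance : One (OrePoly σ δ) := ⟨(1 : F[X])⟩

theorem mul_def (p q : OrePoly σ δ) : p * q = mulLeftHom σ δ p q := mulFun_eq σ δ p q

theorem mulLeftHom_one : mulLeftHom σ δ (1 : F[X]) = 1 := by
  rw [← Polynomial.monomial_zero_one, mulLeftHom_monomial]; simp

theorem map_delta_one : δ.toAddMonoidHom 1 = 0 := by
  have h : δ.toAddMonoidHom (1 * 1) = σ 1 * δ.toAddMonoidHom 1 + δ.toAddMonoidHom 1 * 1 :=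
    δ.leibniz' 1 1
  simpa using h

theorem mulLeftHom_apply_one (p : F[X]) : mulLeftHom σ δ p (1 : F[X]) = p := by
  induction p using Polynomial.induction_on' with
  | add p q hp hq => rw [map_add, end_add_apply, hp, hq]
  | monomial n b =>
    have key : (dMul σ δ ^ n) (1 : F[X]) = monomial n 1 := by
      induction n with
      | zero => simp
      | succ n ih => rw [pow_succ', end_mul_apply, ih, dMul_monomial, map_delta_one]; simp
    rw [mulLeftHom_monomial, end_mul_apply, key]
    change b • monomial n (1 : F) = _
    rw [smul_monomial, smul_eq_mul, mul_one]

noncomputable instance : Ring (OrePoly σ δ) where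
  __ := (inferInstance : AddCommGroup (OrePoly σ δ))
  left_distrib p q r := by simp only [mul_def]; exact map_add (mulLeftHom σ δ p) q r
  right_distrib p q r := by
    simp only [mul_def]
    exact DFunLike.congr_fun (map_add (mulLeftHom σ δ) p q) r
  zero_mul p := by
    rw [mul_def]
    exact DFunLike.congr_fun (map_zero (mulLeftHom σ δ)) p
  mul_zero p := by rw [mul_def]; exact map_zero (mulLeftHom σ δ p)
  mul_assoc p q r := by
    rw [mul_def _ _ (p * q), mul_def _ _ p, mul_def _ _ p, mul_def _ _ q]
    exact DFunLike.congr_fun (mulLeftHom_mul σ δ p q) r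
  one_mul p := by rw [mul_def]; exact DFunLike.congr_fun (mulLeftHom_one σ δ) p
  mul_one p := by rw [mul_def]; exact mulLeftHom_apply_one σ δ p
  neg_add_cancel p := neg_add_cancel p

/-- The indeterminate `∂`. -/
noncomputable def D : OrePoly σ δ := (X : F[X])

/-- The constants `F ⊆ F[∂; σ, δ]`. -/
noncomputable def const (a : F) : OrePoly σ δ := (C a : F[X])

/-- The commutation rule `∂ a = σ(a) ∂ + δ(a)`. -/
theorem D_mul_const (a : F) :
    D σ δ * const σ δ a = const σ δ (σ a) * D σ δ + const σ δ (δ.toAddMonoidHom a) := by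
  rw [mul_def, mul_def]
  change mulLeftHom σ δ (X : F[X]) (C a) =
    mulLeftHom σ δ (C (σ a)) (X : F[X]) + C (δ.toAddMonoidHom a)
  rw [← monomial_one_one_eq_X, ← monomial_zero_left, ← monomial_zero_left, ← monomial_zero_left,
    mulLeftHom_monomial, mulLeftHom_monomial, map_one, one_mul, pow_one, pow_zero, mul_one]
  change dMul σ δ (monomial 0 a) = σ a • monomial 1 (1 : F) + _
  rw [dMul_monomial, smul_monomial, smul_eq_mul, mul_one]

/-- Every Ore polynomial is `∑ aₖ ∂ᵏ` with `aₖ` its coefficients. -/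
theorem eq_sum_const_mul_D_pow (p : OrePoly σ δ) :
    p = ∑ k ∈ Finset.range (Polynomial.natDegree (R := F) p + 1),
      const σ δ (Polynomial.coeff (R := F) p k) * D σ δ ^ k := by
  have hD : ∀ k : ℕ, D σ δ ^ k = (monomial k (1 : F) : F[X]) := by
    intro k
    induction k with
    | zero => rfl
    | succ k ih =>
      have h : mulLeftHom σ δ (monomial 1 (1 : F)) (monomial k (1 : F)) =
          monomial (k + 1) (1 : F) := by
        rw [mulLeftHom_monomial, map_one, one_mul, pow_one, dMul_monomial, map_delta_one]
        simp
      rw [pow_succ', ih]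
      rw [monomial_one_one_eq_X] at h
      exact (mulFun_eq σ δ _ _).trans h
  have hterm : ∀ (k : ℕ) (a : F), const σ δ a * D σ δ ^ k = (monomial k a : F[X]) := by
    intro k a
    have h : mulLeftHom σ δ (monomial 0 a) (monomial k (1 : F)) = monomial k a := by
      rw [mulLeftHom_monomial, pow_zero, mul_one]
      change a • monomial k (1 : F) = _
      rw [smul_monomial, smul_eq_mul, mul_one]
    rw [hD]
    exact (mulFun_eq σ δ _ _).trans h
  simp only [hterm]
  exact Polynomial.as_sum_range (R := F) p

variable {σ δ}

/-- The coefficient of `∂ᵏ`, coefficients being written on the left. -/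
noncomputable def coeff (p : OrePoly σ δ) (k : ℕ) : F := Polynomial.coeff (R := F) p k

/-- The degree in `∂`, with the zero polynomial of degree `⊥ = -∞`. -/
noncomputable def degree (p : OrePoly σ δ) : WithBot ℕ := Polynomial.degree (R := F) p

/-- The degree in `∂` as a natural number (used for nonzero polynomials). -/
noncomputable def natDegree (p : OrePoly σ δ) : ℕ := Polynomial.natDegree (R := F) p

/-- The coefficient of the highest power of `∂` is `1`. -/
def Monic (p : OrePoly σ δ) : Prop := p.coeff p.natDegree = 1

variable {n : ℕ}

/-- The left `F[∂; σ, δ]`-module generated by the rows of `A`. -/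
noncomputable def rowModule (A : Matrix (Fin n) (Fin n) (OrePoly σ δ)) :
    Submodule (OrePoly σ δ) (Fin n → OrePoly σ δ) :=
  Submodule.span (OrePoly σ δ) (Set.range fun i => A i)

/-- The (left row) rank of `A`: the rank of the left module of its rows. -/
noncomputable def rowRank (A : Matrix (Fin n) (Fin n) (OrePoly σ δ)) : ℕ :=
  Module.finrank (OrePoly σ δ) (rowModule A)

/-- Hermite form of a square matrix of full rank: upper triangular, with monic diagonal, every
entry above the diagonal having lower degree than the diagonal entry of its column. -/
structure IsHermite (H : Matrix (Fin n) (Fin n) (OrePoly σ δ)) : Prop where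
  upper : ∀ i j, j < i → H i j = 0
  monic : ∀ i, (H i i).Monic
  reduced : ∀ i j, i < j → (H i j).degree < (H j j).degree

/-- `H` is a Hermite form of `A`: it is in Hermite form and `H = U A` with `U` unimodular,
i.e. invertible over `F[∂; σ, δ]`. -/
def IsHermiteFormOf (H A : Matrix (Fin n) (Fin n) (OrePoly σ δ)) : Prop :=
  IsHermite H ∧ ∃ U : Matrix (Fin n) (Fin n) (OrePoly σ δ), IsUnit U ∧ U * A = H

variable (σ δ) in
/-- The matrix `T` with entries `Tᵢⱼ = ∑_{0 ≤ k ≤ ρ} tᵢⱼₖ ∂ᵏ`. -/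
noncomputable def matrixOfCoeffs {ρ : ℕ} (t : Fin n → Fin n → Fin (ρ + 1) → F) :
    Matrix (Fin n) (Fin n) (OrePoly σ δ) :=
  Matrix.of fun i j => ∑ k : Fin (ρ + 1), const σ δ (t i j k) * D σ δ ^ (k : ℕ)

/-- The values `t` in `F` of the unknowns solve the linear system for `T A`, with target
diagonal degrees `e`. -/
structure IsSolution (A : Matrix (Fin n) (Fin n) (OrePoly σ δ)) (e : Fin n → ℕ) {ρ : ℕ}
    (t : Fin n → Fin n → Fin (ρ + 1) → F) : Prop where
  diag_monic : ∀ i, ((matrixOfCoeffs σ δ t * A) i i).coeff (e i) = 1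
  diag_degree : ∀ i k, e i < k → ((matrixOfCoeffs σ δ t * A) i i).coeff k = 0
  off_diag : ∀ i j k, i ≠ j → e j ≤ k → ((matrixOfCoeffs σ δ t * A) i j).coeff k = 0

end OrePoly

namespace OrePoly

variable {F : Type u} [DivisionRing F] {σ : F ≃+* F} {δ : SigmaDerivation σ}

/-! ### Coefficients -/

/-! Everything rests on additivity of the degree, $\deg(pq)=\deg p+\deg q$, which holds because
$\sigma$ is injective and $\delta$ does not raise degrees. Hence $R$ is a domain, right division by
a monic polynomial works, and left ideals are principal.

Let $M$ be the row module of $A$. Taking, for each $i$, a row of $M$ that vanishes before column $i$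
and has a monic entry of least degree there gives a triangular matrix. Reducing its rows modulo one
another yields $H$ (`exists_isHermiteFormOf`). The rigidity behind uniqueness, (ii) and (iii) is
`IsHermite.eq_zero_of_reduced`: a combination $sH$ whose entries have smaller degree than the
diagonal of $H$ in an initial run of columns has $s=0$ there. So no row of $M$ reduced before column
$l$ has a nonzero entry of degree below $h_l$ in that column, and the diagonal degrees determine
$H$.

The system says that $TA$ has monic diagonal entries of degree $d_i$ and off-diagonal entries of
degree below $d_j$. For $d_i\ge h_i$, reducing the rows $\partial^{d_i}e_i$ modulo $H$ gives some
$SH$ of this shape, and $T=SU$ solves the system once its degree is at most $\varrho$. As the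
diagonal of $H$ dominates its columns, $\deg S\le\varrho-(n-1)d$, and likewise $U^{-1}H=A$ forces
$\deg U^{-1}\le d$. Counting coefficients then gives $\deg U\le(n-1)d$ (`degree_inverse_le`). -/

theorem ext_coeff {p q : OrePoly σ δ} (h : ∀ k, p.coeff k = q.coeff k) : p = q :=
  Polynomial.ext (R := F) h

variable (σ δ) in
/-- The coefficient of `∂ᵏ` as an additive map. -/
noncomputable def coeffHom (k : ℕ) : OrePoly σ δ →+ F where
  toFun p := p.coeff k
  map_zero' := Polynomial.coeff_zero (R := F) k
  map_add' p q := Polynomial.coeff_add (R := F) p q k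

@[simp]
theorem coeff_zero (k : ℕ) : (0 : OrePoly σ δ).coeff k = 0 := map_zero (coeffHom σ δ k)

theorem coeff_add (p q : OrePoly σ δ) (k : ℕ) : (p + q).coeff k = p.coeff k + q.coeff k :=
  map_add (coeffHom σ δ k) p q

theorem coeff_sub (p q : OrePoly σ δ) (k : ℕ) : (p - q).coeff k = p.coeff k - q.coeff k :=
  map_sub (coeffHom σ δ k) p q

theorem coeff_sum {ι : Type*} (s : Finset ι) (f : ι → OrePoly σ δ) (k : ℕ) :
    (∑ i ∈ s, f i).coeff k = ∑ i ∈ s, (f i).coeff k :=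
  map_sum (coeffHom σ δ k) f s

theorem coeff_const_mul (a : F) (p : OrePoly σ δ) (k : ℕ) :
    (const σ δ a * p).coeff k = a * p.coeff k := by
  have h : const σ δ a * p = a • show Polynomial F from p := by
    rw [mul_def]
    change mulLeftHom σ δ (Polynomial.C a) p = _
    rw [← Polynomial.monomial_zero_left, mulLeftHom_monomial, pow_zero, mul_one]
    rfl
  rw [h]
  exact Polynomial.coeff_smul (R := F) a p k

theorem D_mul_eq (p : OrePoly σ δ) : D σ δ * p = dMul σ δ p := by
  rw [mul_def]
  change mulLeftHom σ δ Polynomial.X p = _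
  rw [← Polynomial.monomial_one_one_eq_X, mulLeftHom_monomial, map_one, one_mul, pow_one]

theorem coeff_dMul_succ (p : Polynomial F) (k : ℕ) :
    (dMul σ δ p).coeff (k + 1) = σ (p.coeff k) + δ.toAddMonoidHom (p.coeff (k + 1)) := by
  induction p using Polynomial.induction_on' with
  | add p q hp hq => simp only [map_add, Polynomial.coeff_add, hp, hq]; abel
  | monomial j b =>
    simp only [dMul_monomial, Polynomial.coeff_add, Polynomial.coeff_monomial,
      Nat.add_right_cancel_iff]
    split_ifs <;> simp

theorem coeff_D_mul_succ (p : OrePoly σ δ) (k : ℕ) :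
    (D σ δ * p).coeff (k + 1) = σ (p.coeff k) + δ.toAddMonoidHom (p.coeff (k + 1)) := by
  rw [D_mul_eq]
  exact coeff_dMul_succ p k

theorem D_pow_eq (k : ℕ) : D σ δ ^ k = (Polynomial.monomial k (1 : F) : Polynomial F) := by
  induction k with
  | zero => rfl
  | succ k ih =>
    have h : dMul σ δ (Polynomial.monomial k 1) = Polynomial.monomial (k + 1) (1 : F) := by
      rw [dMul_monomial, map_delta_one, map_one, map_zero, add_zero]
    rw [pow_succ', D_mul_eq, ih]
    exact h

theorem coeff_D_pow (k m : ℕ) : (D σ δ ^ k).coeff m = if k = m then 1 else 0 := by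
  rw [D_pow_eq]
  exact Polynomial.coeff_monomial

theorem coeff_const_mul_D_pow (a : F) (k m : ℕ) :
    (const σ δ a * D σ δ ^ k).coeff m = if k = m then a else 0 := by
  rw [coeff_const_mul, coeff_D_pow, mul_ite, mul_one, mul_zero]

/-! ### Degrees -/

theorem degree_le_iff {p : OrePoly σ δ} {k : ℕ} :
    p.degree ≤ k ↔ ∀ m, k < m → p.coeff m = 0 :=
  (Polynomial.degree_le_iff_coeff_zero (R := F) p k).trans
    (forall_congr' fun _ => by rw [Nat.cast_lt]; rfl)

theorem degree_lt_iff {p : OrePoly σ δ} {k : ℕ} :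
    p.degree < k ↔ ∀ m, k ≤ m → p.coeff m = 0 :=
  Polynomial.degree_lt_iff_coeff_zero (R := F) p k

theorem degree_eq_bot {p : OrePoly σ δ} : p.degree = ⊥ ↔ p = 0 :=
  Polynomial.degree_eq_bot (R := F)

@[simp]
theorem degree_zero : (0 : OrePoly σ δ).degree = ⊥ := degree_eq_bot.2 rfl

theorem degree_eq_natDegree {p : OrePoly σ δ} (hp : p ≠ 0) : p.degree = p.natDegree :=
  Polynomial.degree_eq_natDegree (R := F) hp

theorem coeff_natDegree_ne_zero {p : OrePoly σ δ} (hp : p ≠ 0) : p.coeff p.natDegree ≠ 0 :=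
  (Polynomial.leadingCoeff_ne_zero (R := F)).2 hp

theorem le_degree_of_ne_zero {p : OrePoly σ δ} {k : ℕ} (h : p.coeff k ≠ 0) :
    (k : WithBot ℕ) ≤ p.degree :=
  Polynomial.le_degree_of_ne_zero (R := F) h

theorem degree_eq_of_coeff {p : OrePoly σ δ} {k : ℕ} (h : ∀ m, k < m → p.coeff m = 0)
    (hk : p.coeff k ≠ 0) : p.degree = k :=
  le_antisymm (degree_le_iff.2 h) (le_degree_of_ne_zero hk)

theorem natDegree_eq_of_degree_eq {p : OrePoly σ δ} {k : ℕ} (h : p.degree = k) :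
    p.natDegree = k :=
  Polynomial.natDegree_eq_of_degree_eq_some (R := F) h

theorem coeff_eq_zero_of_degree_lt {p : OrePoly σ δ} {k : ℕ} (h : p.degree < k) :
    p.coeff k = 0 :=
  Polynomial.coeff_eq_zero_of_degree_lt (R := F) h

theorem degree_add_le (p q : OrePoly σ δ) : (p + q).degree ≤ max p.degree q.degree :=
  Polynomial.degree_add_le (R := F) p q

theorem degree_sub_lt_of_lt {p q : OrePoly σ δ} {b : WithBot ℕ} (hp : p.degree < b)
    (hq : q.degree < b) : (p - q).degree < b :=
  (Polynomial.degree_sub_le (R := F) p q).trans_lt (max_lt hp hq)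

theorem degree_neg (p : OrePoly σ δ) : (-p).degree = p.degree :=
  Polynomial.degree_neg (R := F) p

theorem degree_sum_le {ι : Type*} (s : Finset ι) (f : ι → OrePoly σ δ) {b : WithBot ℕ}
    (h : ∀ i ∈ s, (f i).degree ≤ b) : (∑ i ∈ s, f i).degree ≤ b := by
  classical
  induction s using Finset.induction_on with
  | empty => simp
  | insert a s ha ih =>
    rw [Finset.sum_insert ha]
    exact (degree_add_le _ _).trans (max_le (h a (Finset.mem_insert_self a s))
      (ih fun i hi => h i (Finset.mem_insert_of_mem hi)))

theorem degree_add_eq_left {p q : OrePoly σ δ} (h : q.degree < p.degree) :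
    (p + q).degree = p.degree :=
  Polynomial.degree_add_eq_left_of_degree_lt (R := F) h

theorem Monic.ne_zero {p : OrePoly σ δ} (hp : p.Monic) : p ≠ 0 := by
  rintro rfl
  exact zero_ne_one ((coeff_zero _).symm.trans hp)

theorem Monic.degree_eq {p : OrePoly σ δ} (hp : p.Monic) : p.degree = p.natDegree :=
  degree_eq_natDegree hp.ne_zero

theorem monic_of_coeff {p : OrePoly σ δ} {k : ℕ} (h : ∀ m, k < m → p.coeff m = 0)
    (hk : p.coeff k = 1) : p.Monic ∧ p.natDegree = k := by
  have := natDegree_eq_of_degree_eq (degree_eq_of_coeff h (hk.trans_ne one_ne_zero))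
  exact ⟨by rw [Monic, this, hk], this⟩

/-! ### Ore polynomials of bounded degree -/

variable (σ δ) in
/-- The Ore polynomial of degree at most `ρ` with prescribed coefficients. -/
noncomputable def ofCoeffs {ρ : ℕ} (t : Fin (ρ + 1) → F) : OrePoly σ δ :=
  ∑ k : Fin (ρ + 1), const σ δ (t k) * D σ δ ^ (k : ℕ)

theorem coeff_ofCoeffs {ρ : ℕ} (t : Fin (ρ + 1) → F) (k : Fin (ρ + 1)) :
    (ofCoeffs σ δ t).coeff k = t k := by
  simp [ofCoeffs, coeff_sum, coeff_const_mul_D_pow, Fin.val_inj]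

theorem degree_ofCoeffs {ρ : ℕ} (t : Fin (ρ + 1) → F) : (ofCoeffs σ δ t).degree ≤ ρ := by
  refine degree_le_iff.2 fun m hm => ?_
  rw [ofCoeffs, coeff_sum]
  refine Finset.sum_eq_zero fun k _ => ?_
  rw [coeff_const_mul_D_pow, if_neg]
  omega

theorem ofCoeffs_coeff {ρ : ℕ} {p : OrePoly σ δ} (hp : p.degree ≤ ρ) :
    ofCoeffs σ δ (fun k : Fin (ρ + 1) => p.coeff k) = p := by
  refine ext_coeff fun m => ?_
  by_cases hm : m < ρ + 1
  · exact coeff_ofCoeffs _ ⟨m, hm⟩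
  · rw [degree_le_iff.1 hp m (by omega), degree_le_iff.1 (degree_ofCoeffs _) m (by omega)]

theorem ofCoeffs_injective {ρ : ℕ} :
    Function.Injective (ofCoeffs σ δ : (Fin (ρ + 1) → F) → OrePoly σ δ) := fun s t h => by
  funext k
  rw [← coeff_ofCoeffs (σ := σ) (δ := δ) s k, h, coeff_ofCoeffs]

/-! ### Multiplicativity of the degree -/

/-- Each multiplication by $\partial$ shifts the top term and twists it by $\sigma$; the $\delta$
part stays in the old degree. -/
theorem coeff_D_pow_mul {q : OrePoly σ δ} {b : ℕ} (hq : ∀ m, b < m → q.coeff m = 0) (i : ℕ) :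
    (∀ m, i + b < m → (D σ δ ^ i * q).coeff m = 0) ∧
      (D σ δ ^ i * q).coeff (i + b) = σ^[i] (q.coeff b) := by
  induction i with
  | zero => simpa using hq
  | succ i ih =>
    simp only [pow_succ', mul_assoc]
    refine ⟨fun m hm => ?_, ?_⟩
    · obtain ⟨m, rfl⟩ : ∃ m', m = m' + 1 := ⟨m - 1, by omega⟩
      rw [coeff_D_mul_succ, ih.1 _ (by omega), ih.1 _ (by omega), map_zero, map_zero, add_zero]
    · rw [show i + 1 + b = i + b + 1 by ring, coeff_D_mul_succ, ih.1 (i + b + 1) (by omega), ih.2,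
        map_zero, add_zero, Function.iterate_succ_apply']

theorem coeff_mul_of_le {p q : OrePoly σ δ} {a b : ℕ} (hp : ∀ m, a < m → p.coeff m = 0)
    (hq : ∀ m, b < m → q.coeff m = 0) :
    (∀ m, a + b < m → (p * q).coeff m = 0) ∧
      (p * q).coeff (a + b) = p.coeff a * σ^[a] (q.coeff b) := by
  have key : ∀ m, (p * q).coeff m =
      ∑ k : Fin (a + 1), p.coeff k * (D σ δ ^ (k : ℕ) * q).coeff m := by
    intro m
    conv_lhs => rw [← ofCoeffs_coeff (degree_le_iff.2 hp), ofCoeffs, Finset.sum_mul]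
    simp only [coeff_sum, mul_assoc, coeff_const_mul]
  refine ⟨fun m hm => ?_, ?_⟩
  · rw [key]
    refine Finset.sum_eq_zero fun k _ => ?_
    rw [(coeff_D_pow_mul hq k).1 m (by omega), mul_zero]
  · rw [key, Finset.sum_eq_single (Fin.last a)]
    · rw [Fin.val_last, (coeff_D_pow_mul hq a).2]
    · intro k _ hk
      have : (k : ℕ) < a := Fin.val_lt_last hk
      rw [(coeff_D_pow_mul hq k).1 _ (by omega), mul_zero]
    · simp

theorem coeff_natDegree_lt (p : OrePoly σ δ) : ∀ m, p.natDegree < m → p.coeff m = 0 :=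
  fun _ hm => Polynomial.coeff_eq_zero_of_natDegree_lt (R := F) hm

theorem iterate_ne_zero {a : F} (ha : a ≠ 0) (k : ℕ) : σ^[k] a ≠ 0 := by
  induction k with
  | zero => exact ha
  | succ k ih =>
    rw [Function.iterate_succ_apply']
    exact (map_ne_zero_iff σ σ.injective).2 ih

theorem degree_mul_of_ne_zero {p q : OrePoly σ δ} (hp : p ≠ 0) (hq : q ≠ 0) :
    (p * q).degree = ((p.natDegree + q.natDegree : ℕ) : WithBot ℕ) := by
  obtain ⟨h1, h2⟩ := coeff_mul_of_le (coeff_natDegree_lt p) (coeff_natDegree_lt q)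
  refine degree_eq_of_coeff h1 ?_
  rw [h2]
  exact mul_ne_zero (coeff_natDegree_ne_zero hp) (iterate_ne_zero (coeff_natDegree_ne_zero hq) _)

theorem degree_mul (p q : OrePoly σ δ) : (p * q).degree = p.degree + q.degree := by
  rcases eq_or_ne p 0 with rfl | hp
  · simp
  rcases eq_or_ne q 0 with rfl | hq
  · simp
  rw [degree_mul_of_ne_zero hp hq, degree_eq_natDegree hp, degree_eq_natDegree hq]
  rfl

instance : Nontrivial (OrePoly σ δ) := inferInstanceAs (Nontrivial (Polynomial F))

instance : IsDomain (OrePoly σ δ) :=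
  have : NoZeroDivisors (OrePoly σ δ) := ⟨fun {p q} h => by
    by_contra! hpq
    have := degree_mul_of_ne_zero hpq.1 hpq.2
    rw [h, degree_zero] at this
    exact WithBot.bot_ne_coe this⟩
  NoZeroDivisors.to_isDomain _

/-! ### Right division by a monic Ore polynomial -/

theorem exists_degree_sub_mul_lt {g : OrePoly σ δ} (hg : g.Monic) (w : OrePoly σ δ) :
    ∃ q, (w - q * g).degree < g.degree := by
  have aux : ∀ (m : ℕ) (w : OrePoly σ δ), w.degree < m → ∃ q, (w - q * g).degree < g.degree := by
    intro m
    induction m with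
    | zero =>
      intro w hw
      refine ⟨0, ?_⟩
      rw [zero_mul, sub_zero, hg.degree_eq]
      exact hw.trans_le (by exact_mod_cast Nat.zero_le _)
    | succ m ih =>
      intro w hw
      by_cases hm : m < g.natDegree
      · refine ⟨0, ?_⟩
        rw [zero_mul, sub_zero, hg.degree_eq]
        exact hw.trans_le (by exact_mod_cast hm)
      -- This cancels the top term of $w$: $g$ is monic and $\sigma$ fixes $1$, so no twist has to
      -- be undone.
      set c := const σ δ (w.coeff m) * D σ δ ^ (m - g.natDegree) with hc
      have hcc : ∀ k, m - g.natDegree < k → c.coeff k = 0 := fun k hk => by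
        rw [hc, coeff_const_mul_D_pow, if_neg (by omega)]
      obtain ⟨h1, h2⟩ := coeff_mul_of_le hcc (coeff_natDegree_lt g)
      rw [show m - g.natDegree + g.natDegree = m by omega] at h1 h2
      rw [hg, hc, coeff_const_mul_D_pow, if_pos rfl, ← hc, iterate_map_one, mul_one] at h2
      obtain ⟨q, hq⟩ := ih (w - c * g) (degree_lt_iff.2 fun k hk => by
        rw [coeff_sub]
        rcases hk.eq_or_lt with rfl | hk
        · rw [h2, sub_self]
        · rw [h1 k hk, degree_lt_iff.1 hw k hk, sub_zero])
      exact ⟨c + q, by rwa [add_mul, ← sub_sub]⟩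
  refine aux (w.natDegree + 1) w (degree_lt_iff.2 fun m hm => coeff_natDegree_lt w m hm)

open Matrix

/-! ### Left ideals are principal -/

theorem exists_const_mul_monic {p : OrePoly σ δ} (hp : p ≠ 0) :
    ∃ a : F, (const σ δ a * p).Monic ∧ (const σ δ a * p).natDegree = p.natDegree :=
  ⟨(p.coeff p.natDegree)⁻¹, monic_of_coeff
    (fun m hm => by rw [coeff_const_mul, coeff_natDegree_lt p m hm, mul_zero])
    (by rw [coeff_const_mul, inv_mul_cancel₀ (coeff_natDegree_ne_zero hp)])⟩

/-- A nonzero left ideal contains a monic element of minimal degree. -/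
theorem exists_monic_minimal (I : Ideal (OrePoly σ δ)) (hI : I ≠ ⊥) :
    ∃ g ∈ I, g.Monic ∧ ∀ p ∈ I, p.degree < g.degree → p = 0 := by
  classical
  have hex : ∃ m : ℕ, ∃ p ∈ I, p ≠ 0 ∧ p.natDegree = m := by
    obtain ⟨p, hp, hp0⟩ := I.ne_bot_iff.1 hI
    exact ⟨_, p, hp, hp0, rfl⟩
  obtain ⟨p, hp, hp0, hpd⟩ := Nat.find_spec hex
  obtain ⟨a, hmon, hdeg⟩ := exists_const_mul_monic hp0
  refine ⟨_, I.mul_mem_left _ hp, hmon, fun r hr hlt => ?_⟩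
  by_contra hr0
  rw [hmon.degree_eq, degree_eq_natDegree hr0, hdeg, hpd] at hlt
  exact Nat.find_min hex (by exact_mod_cast hlt) ⟨r, hr, hr0, rfl⟩

/-- The remainder on division by a monic element of least degree lies in the left ideal, hence
vanishes. A left principal ideal domain is an Ore domain, where rank detects linear independence. -/
instance : IsPrincipalIdealRing (OrePoly σ δ) where
  principal I := by
    by_cases hI : I = ⊥
    · exact ⟨⟨0, by rw [hI, Submodule.span_zero_singleton]⟩⟩
    obtain ⟨g, hgI, hg, hmin⟩ := exists_monic_minimal I hI
    refine ⟨⟨g, le_antisymm (fun w hw => ?_) ?_⟩⟩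
    · obtain ⟨q, hq⟩ := exists_degree_sub_mul_lt hg w
      have h0 := hmin _ (I.sub_mem hw (I.mul_mem_left q hgI)) hq
      rw [sub_eq_zero.1 h0]
      exact Submodule.smul_mem _ q (Submodule.mem_span_singleton_self g)
    · rw [Submodule.span_le, Set.singleton_subset_iff]
      exact hgI

variable {n : ℕ}

/-! ### Matrices with trivial left kernel -/

/-- Since $n$ rows spanning a module of rank $n$ are independent, full rank enters the rest of the
proof only as a trivial left kernel. -/
theorem vecMul_eq_zero_of_rowRank {A : Matrix (Fin n) (Fin n) (OrePoly σ δ)}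
    (hA : rowRank A = n) (u : Fin n → OrePoly σ δ) (hu : u ᵥ* A = 0) : u = 0 := by
  have hli : LinearIndependent (OrePoly σ δ) (fun i => A i) := by
    rw [linearIndependent_iff_card_le_finrank_span, Fintype.card_fin]
    exact hA.ge
  refine funext (Fintype.linearIndependent_iff.1 hli u ?_)
  rw [← hu, vecMul_eq_sum]

theorem eq_of_mul_eq_mul_right {A S T : Matrix (Fin n) (Fin n) (OrePoly σ δ)}
    (hA : ∀ u, u ᵥ* A = 0 → u = 0) (h : S * A = T * A) : S = T := by
  refine Matrix.ext fun i j => congrFun (sub_eq_zero.1 (hA ((S i : Fin n → OrePoly σ δ) - T i) ?_)) j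
  rw [sub_vecMul, sub_eq_zero]
  exact congrFun h i

/-! ### Degree bounds by counting coefficients -/

theorem degree_vecMul_le {A : Matrix (Fin n) (Fin n) (OrePoly σ δ)} {d s : ℕ}
    (hd : ∀ i j, (A i j).degree ≤ d) {u : Fin n → OrePoly σ δ} (hu : ∀ i, (u i).degree ≤ s)
    (j : Fin n) : ((u ᵥ* A) j).degree ≤ ((s + d : ℕ) : WithBot ℕ) := by
  refine degree_sum_le Finset.univ (fun i => u i * A i j) fun i _ => ?_
  rw [degree_mul, Nat.cast_add]
  exact add_le_add (hu i) (hd i j)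

theorem ofCoeffs_add {ρ : ℕ} (t t' : Fin (ρ + 1) → F) :
    ofCoeffs σ δ (t + t') = ofCoeffs σ δ t + ofCoeffs σ δ t' := by
  refine ext_coeff fun m => ?_
  simp only [ofCoeffs, coeff_add, coeff_sum, coeff_const_mul, ← Finset.sum_add_distrib,
    Pi.add_apply, add_mul]

theorem ofCoeffs_smul {ρ : ℕ} (a : F) (t : Fin (ρ + 1) → F) :
    ofCoeffs σ δ (a • t) = const σ δ a * ofCoeffs σ δ t := by
  refine ext_coeff fun m => ?_
  simp only [ofCoeffs, coeff_sum, coeff_const_mul, Finset.mul_sum, Pi.smul_apply, smul_eq_mul,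
    mul_assoc]

/-- Counting coefficients: `n - 1` homogeneous equations of degree `≤ d` in `n` unknown Ore
polynomials have a nonzero solution of degree `≤ (n - 1) d`. -/
theorem exists_vecMul_eq_zero_off {A : Matrix (Fin n) (Fin n) (OrePoly σ δ)} {d : ℕ}
    (hd : ∀ i j, (A i j).degree ≤ d) (i : Fin n) :
    ∃ u : Fin n → OrePoly σ δ, u ≠ 0 ∧
      (∀ j, (u j).degree ≤ (((n - 1) * d : ℕ) : WithBot ℕ)) ∧ ∀ j, j ≠ i → (u ᵥ* A) j = 0 := by
  set s := (n - 1) * d with hs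
  -- Coefficients of $uA$ depend left $F$-linearly on those of $u$, because the unknowns stand on
  -- the left.
  let φ : (Fin n → Fin (s + 1) → F) →ₗ[F] ({j : Fin n // j ≠ i} → Fin (s + d + 1) → F) :=
    { toFun := fun t j k => (((fun l => ofCoeffs σ δ (t l)) ᵥ* A) j).coeff k
      map_add' := fun t t' => by
        funext j k
        have : (fun l => ofCoeffs σ δ ((t + t') l)) =
            (fun l => ofCoeffs σ δ (t l)) + fun l => ofCoeffs σ δ (t' l) :=
          funext fun l => ofCoeffs_add (t l) (t' l)
        rw [this, add_vecMul]
        exact coeff_add _ _ _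
      map_smul' := fun a t => by
        funext j k
        have : (fun l => ofCoeffs σ δ ((a • t) l)) =
            const σ δ a • fun l => ofCoeffs σ δ (t l) :=
          funext fun l => ofCoeffs_smul a (t l)
        rw [this, smul_vecMul]
        exact coeff_const_mul _ _ _ }
  -- Unknowns exceed equations by exactly $n(s+1)-(n-1)(s+d+1)=1$ when $s=(n-1)d$.
  have hlt : Module.finrank F ({j : Fin n // j ≠ i} → Fin (s + d + 1) → F) <
      Module.finrank F (Fin n → Fin (s + 1) → F) := by
    obtain ⟨m, rfl⟩ : ∃ m, n = m + 1 := ⟨n - 1, by have := i.pos; omega⟩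
    simp only [Module.finrank_pi_fintype, Module.finrank_self, Finset.sum_const,
      Finset.card_univ, Fintype.card_fin, smul_eq_mul, mul_one, Fintype.card_subtype_compl,
      Fintype.card_subtype_eq, hs, Nat.add_sub_cancel]
    nlinarith
  obtain ⟨t, ht, ht0⟩ := (Submodule.ne_bot_iff _).1 (LinearMap.ker_ne_bot_of_finrank_lt hlt)
  refine ⟨fun l => ofCoeffs σ δ (t l), fun h => ht0 ?_, fun l => degree_ofCoeffs _,
    fun j hj => ext_coeff fun k => ?_⟩
  · funext l k
    rw [← coeff_ofCoeffs (σ := σ) (δ := δ) (t l) k]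
    exact congrArg (fun p : OrePoly σ δ => p.coeff k) (congrFun h l)
  · by_cases hk : k < s + d + 1
    · have h0 : φ t = 0 := LinearMap.mem_ker.1 ht
      exact congrFun (congrFun h0 ⟨j, hj⟩) ⟨k, hk⟩
    · exact degree_le_iff.1 (degree_vecMul_le hd (fun l => degree_ofCoeffs (t l)) j) k (by omega)

theorem exists_vecMul_ne_zero {A : Matrix (Fin n) (Fin n) (OrePoly σ δ)} {d : ℕ}
    (hd : ∀ i j, (A i j).degree ≤ d) (hA : ∀ u, u ᵥ* A = 0 → u = 0) (i : Fin n) :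
    ∃ u : Fin n → OrePoly σ δ, (∀ j, (u j).degree ≤ (((n - 1) * d : ℕ) : WithBot ℕ)) ∧
      (∀ j, j ≠ i → (u ᵥ* A) j = 0) ∧ (u ᵥ* A) i ≠ 0 := by
  obtain ⟨u, hu0, hu, hz⟩ := exists_vecMul_eq_zero_off hd i
  refine ⟨u, hu, hz, fun h => hu0 (hA u (funext fun j => ?_))⟩
  by_cases hj : j = i
  · rw [hj]; exact h
  · exact hz j hj

/-- The inverse of a unimodular matrix of degree `≤ d` has degree `≤ (n - 1) d`. -/
theorem degree_inverse_le {U V : Matrix (Fin n) (Fin n) (OrePoly σ δ)} {d : ℕ}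
    (hd : ∀ i j, (V i j).degree ≤ d) (hVU : V * U = 1) (i j : Fin n) :
    (U i j).degree ≤ (((n - 1) * d : ℕ) : WithBot ℕ) := by
  have hV : ∀ u, u ᵥ* V = 0 → u = 0 := fun u hu => by
    rw [← vecMul_one u, ← hVU, ← vecMul_vecMul, hu, zero_vecMul]
  obtain ⟨u, hu, hz, hne⟩ := exists_vecMul_ne_zero hd hV i
  have hs : u ᵥ* V = Pi.single i ((u ᵥ* V) i) := by
    funext k
    by_cases hk : k = i
    · subst hk; simp
    · rw [hz k hk, Pi.single_eq_of_ne hk]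
  -- Since $uV$ is a nonzero multiple of the $i$-th unit row, $u$ is that multiple of row $i$ of
  -- $U$, and a nonzero left factor cannot lower degrees.
  have huj : u j = (u ᵥ* V) i * U i j := by
    have : u = (u ᵥ* V) ᵥ* U := by rw [vecMul_vecMul, hVU, vecMul_one]
    conv_lhs => rw [this, hs, single_vecMul]
    rfl
  have := hu j
  rw [huj, degree_mul] at this
  refine le_trans ?_ this
  rw [degree_eq_natDegree hne]
  exact le_add_of_nonneg_left (by exact_mod_cast Nat.zero_le _)

/-! ### Reduction modulo the rows of a triangular matrix -/

/-- Columns are treated from left to right: subtracting a multiple of row $k$ leaves the columns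
before $k$ unchanged. -/
theorem exists_reduction {G : Matrix (Fin n) (Fin n) (OrePoly σ δ)}
    (hG : ∀ i j, j < i → G i j = 0) (hmon : ∀ i, (G i i).Monic) (w : Fin n → OrePoly σ δ) :
    ∃ q : Fin n → OrePoly σ δ, ∀ j, ((w - q ᵥ* G) j).degree < (G j j).degree := by
  have aux : ∀ k : ℕ, k ≤ n → ∃ q : Fin n → OrePoly σ δ,
      ∀ j : Fin n, (j : ℕ) < k → ((w - q ᵥ* G) j).degree < (G j j).degree := by
    intro k
    induction k with
    | zero => exact fun _ => ⟨0, fun j hj => absurd hj (Nat.not_lt_zero _)⟩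
    | succ k ih =>
      intro hk
      obtain ⟨q, hq⟩ := ih (by omega)
      obtain ⟨c, hc⟩ := exists_degree_sub_mul_lt (hmon ⟨k, hk⟩) ((w - q ᵥ* G) ⟨k, hk⟩)
      have hrow : ∀ j, (w - (q + Pi.single ⟨k, hk⟩ c) ᵥ* G) j =
          (w - q ᵥ* G) j - c * G ⟨k, hk⟩ j := fun j => by
        rw [add_vecMul, single_vecMul, ← sub_sub]
        rfl
      refine ⟨q + Pi.single ⟨k, hk⟩ c, fun j hj => ?_⟩
      rw [hrow]
      rcases (Nat.lt_succ_iff.1 hj).eq_or_lt with rfl | hj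
      · exact hc
      · rw [hG ⟨k, hk⟩ j hj, mul_zero, sub_zero]
        exact hq j hj
  obtain ⟨q, hq⟩ := aux n le_rfl
  exact ⟨q, fun j => hq j j.2⟩

/-! ### Rows reduced modulo a Hermite form -/

/-- If the first columns of `s H` are reduced modulo the diagonal of `H`, then the corresponding
entries of `s` vanish. -/
theorem IsHermite.eq_zero_of_reduced {H : Matrix (Fin n) (Fin n) (OrePoly σ δ)}
    (hH : IsHermite H) {s : Fin n → OrePoly σ δ} {l : Fin n}
    (h : ∀ j, j ≤ l → ((s ᵥ* H) j).degree < (H j j).degree) : ∀ j, j ≤ l → s j = 0 := by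
  intro j
  induction j using WellFoundedLT.induction with
  | ind j ih =>
    intro hj
    -- Only the diagonal term survives: earlier $s_k$ vanish by induction, later $H_{kj}$ by
    -- triangularity. A nonzero $s_j$ would then give degree at least that of $H_{jj}$.
    have hsum : ∑ k, s k * H k j = s j * H j j := by
      refine Finset.sum_eq_single j (fun k _ hk => ?_) fun hk => absurd (Finset.mem_univ j) hk
      rcases lt_or_gt_of_ne hk with hk | hk
      · rw [ih k hk (hk.le.trans hj), zero_mul]
      · rw [hH.upper k j hk, mul_zero]
    have hlt := h j hj
    by_contra hne
    rw [show (s ᵥ* H) j = s j * H j j from hsum,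
      degree_mul_of_ne_zero hne (hH.monic j).ne_zero, (hH.monic j).degree_eq] at hlt
    have : (s j).natDegree + (H j j).natDegree < (H j j).natDegree := by exact_mod_cast hlt
    omega

theorem IsHermite.eq_zero_of_forall_reduced {H : Matrix (Fin n) (Fin n) (OrePoly σ δ)}
    (hH : IsHermite H) {s : Fin n → OrePoly σ δ}
    (h : ∀ j, ((s ᵥ* H) j).degree < (H j j).degree) : s = 0 :=
  funext fun j => hH.eq_zero_of_reduced (l := j) (fun k _ => h k) j le_rfl

theorem IsHermite.degree_off_diag_lt {H : Matrix (Fin n) (Fin n) (OrePoly σ δ)}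
    (hH : IsHermite H) {i j : Fin n} (hij : i ≠ j) : (H i j).degree < (H j j).degree := by
  rcases lt_or_gt_of_ne hij with h | h
  · exact hH.reduced i j h
  · rw [hH.upper i j h, degree_zero, (hH.monic j).degree_eq]
    exact WithBot.bot_lt_coe _

theorem IsHermite.eq_zero_of_vecMul {H : Matrix (Fin n) (Fin n) (OrePoly σ δ)}
    (hH : IsHermite H) (s : Fin n → OrePoly σ δ) (hs : s ᵥ* H = 0) : s = 0 :=
  hH.eq_zero_of_forall_reduced fun j => by
    rw [hs, Pi.zero_apply, degree_zero, (hH.monic j).degree_eq]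
    exact WithBot.bot_lt_coe _

/-- In each column of a Hermite form the diagonal entry dominates, so that a bound on the degrees
of `s H` gives one on those of `s`. -/
theorem IsHermite.degree_le_of_vecMul {H : Matrix (Fin n) (Fin n) (OrePoly σ δ)}
    (hH : IsHermite H) {s : Fin n → OrePoly σ δ} {c : ℕ}
    (h : ∀ j, ((s ᵥ* H) j).degree ≤ ((c + (H j j).natDegree : ℕ) : WithBot ℕ)) (k : Fin n) :
    (s k).degree ≤ c := by
  -- With $s_m$ of maximal degree, $s_mH_{mm}$ strictly dominates every other term of column $m$, so
  -- nothing cancels.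
  obtain ⟨m, -, hm⟩ := Finset.exists_max_image Finset.univ (fun k => (s k).degree)
    ⟨k, Finset.mem_univ k⟩
  refine (hm k (Finset.mem_univ k)).trans ?_
  by_cases h0 : s m = 0
  · rw [h0, degree_zero]; exact bot_le
  have hsplit : (s ᵥ* H) m = s m * H m m + ∑ l ∈ Finset.univ.erase m, s l * H l m :=
    (Finset.add_sum_erase _ _ (Finset.mem_univ m)).symm
  have hrest : (∑ l ∈ Finset.univ.erase m, s l * H l m).degree < (s m * H m m).degree := by
    rw [degree_mul_of_ne_zero h0 (hH.monic m).ne_zero]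
    refine degree_lt_iff.2 fun x hx => ?_
    rw [coeff_sum]
    refine Finset.sum_eq_zero fun l hl => coeff_eq_zero_of_degree_lt ?_
    by_cases hl0 : s l = 0
    · rw [hl0, zero_mul, degree_zero]; exact WithBot.bot_lt_coe _
    have h1 := hH.degree_off_diag_lt (Finset.ne_of_mem_erase hl)
    have h2 := hm l (Finset.mem_univ l)
    by_cases hz : H l m = 0
    · rw [hz, mul_zero, degree_zero]; exact WithBot.bot_lt_coe _
    rw [degree_mul_of_ne_zero hl0 hz]
    rw [degree_eq_natDegree hz, (hH.monic m).degree_eq] at h1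
    rw [degree_eq_natDegree hl0, degree_eq_natDegree h0] at h2
    have h1' : (H l m).natDegree < (H m m).natDegree := by exact_mod_cast h1
    have h2' : (s l).natDegree ≤ (s m).natDegree := by exact_mod_cast h2
    have : (s l).natDegree + (H l m).natDegree < x := by omega
    exact_mod_cast this
  have := h m
  rw [hsplit, degree_add_eq_left hrest, degree_mul_of_ne_zero h0 (hH.monic m).ne_zero] at this
  have h' : (s m).natDegree + (H m m).natDegree ≤ c + (H m m).natDegree := by exact_mod_cast this
  rw [degree_eq_natDegree h0]
  exact_mod_cast (by omega : (s m).natDegree ≤ c)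

/-! ### Prescribed diagonal degrees -/

theorem monic_D_pow_sub {r : OrePoly σ δ} {e : ℕ} (hr : r.degree < e) :
    (D σ δ ^ e - r).Monic ∧ (D σ δ ^ e - r).natDegree = e := by
  refine monic_of_coeff (fun m hm => ?_) ?_
  · rw [coeff_sub, coeff_D_pow, if_neg hm.ne, degree_lt_iff.1 hr m hm.le, sub_zero]
  · rw [coeff_sub, coeff_D_pow, if_pos rfl, degree_lt_iff.1 hr e le_rfl, sub_zero]

/-- The row module of a triangular matrix contains rows with any large enough diagonal
degrees `e`, reduced off the diagonal. -/
theorem exists_mul_of_le {G : Matrix (Fin n) (Fin n) (OrePoly σ δ)}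
    (hG : ∀ i j, j < i → G i j = 0) (hmon : ∀ i, (G i i).Monic) {e : Fin n → ℕ}
    (he : ∀ i, (G i i).natDegree ≤ e i) :
    ∃ S : Matrix (Fin n) (Fin n) (OrePoly σ δ),
      (∀ i, ((S * G) i i).Monic ∧ ((S * G) i i).natDegree = e i) ∧
      ∀ i j, i ≠ j → ((S * G) i j).degree < (G j j).degree := by
  -- The remainder $r$ of $\partial^{e_i}e_i$ is reduced, so $\partial^{e_i}e_i-r$ lies in the row
  -- module and has the required shape.
  choose q hq using fun i => exists_reduction hG hmon (Pi.single i (D σ δ ^ e i))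
  refine ⟨Matrix.of q, fun i => ?_, fun i j hij => ?_⟩
  · have h := hq i i
    rw [Pi.sub_apply, Pi.single_eq_same] at h
    have hlt := h.trans_le ((hmon i).degree_eq.trans_le
      (by exact_mod_cast he i : _ ≤ ((e i : ℕ) : WithBot ℕ)))
    have := monic_D_pow_sub hlt
    rwa [sub_sub_cancel] at this
  · have h := hq i j
    rwa [Pi.sub_apply, Pi.single_eq_of_ne hij.symm, zero_sub, degree_neg] at h

/-! ### Existence and uniqueness of the Hermite form -/

/-- The $i$-th entries of rows of the module that vanish before column $i$ form a left ideal. It is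
nonzero because some row is supported in column $i$ alone. -/
theorem exists_minimal_row {A : Matrix (Fin n) (Fin n) (OrePoly σ δ)} {d : ℕ}
    (hd : ∀ i j, (A i j).degree ≤ d) (hA : ∀ u, u ᵥ* A = 0 → u = 0) (i : Fin n) :
    ∃ c : Fin n → OrePoly σ δ, (∀ j, j < i → (c ᵥ* A) j = 0) ∧ ((c ᵥ* A) i).Monic ∧
      ∀ u : Fin n → OrePoly σ δ, (∀ j, j < i → (u ᵥ* A) j = 0) →
        ((u ᵥ* A) i).degree < ((c ᵥ* A) i).degree → (u ᵥ* A) i = 0 := by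
  let I : Ideal (OrePoly σ δ) :=
    { carrier := {p | ∃ u : Fin n → OrePoly σ δ, (∀ j, j < i → (u ᵥ* A) j = 0) ∧ (u ᵥ* A) i = p}
      zero_mem' := ⟨0, fun j _ => by rw [zero_vecMul]; rfl, by rw [zero_vecMul]; rfl⟩
      add_mem' := by
        rintro _ _ ⟨u, hu, rfl⟩ ⟨v, hv, rfl⟩
        refine ⟨u + v, fun j hj => ?_, by rw [add_vecMul]; rfl⟩
        rw [add_vecMul, Pi.add_apply, hu j hj, hv j hj, add_zero]
      smul_mem' := by
        rintro c _ ⟨u, hu, rfl⟩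
        refine ⟨c • u, fun j hj => ?_, by rw [smul_vecMul]; rfl⟩
        rw [smul_vecMul, Pi.smul_apply, hu j hj, smul_zero] }
  obtain ⟨u, -, hu, hne⟩ := exists_vecMul_ne_zero hd hA i
  obtain ⟨_, ⟨c, hc, rfl⟩, hmon, hmin⟩ := exists_monic_minimal I
    (I.ne_bot_iff.2 ⟨_, ⟨u, fun j hj => hu j hj.ne, rfl⟩, hne⟩)
  exact ⟨c, hc, hmon, fun u hu => hmin _ ⟨u, hu, rfl⟩⟩

theorem exists_isHermiteFormOf {A : Matrix (Fin n) (Fin n) (OrePoly σ δ)} {d : ℕ}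
    (hd : ∀ i j, (A i j).degree ≤ d) (hA : ∀ u, u ᵥ* A = 0 → u = 0) :
    ∃ H, IsHermiteFormOf H A := by
  choose c hc hmon hmin using exists_minimal_row hd hA
  set G := Matrix.of c * A with hGdef
  have hmonG : ∀ i, (G i i).Monic := hmon
  -- Minimality, applied column by column, kills any row of the module that is reduced modulo the
  -- diagonal of $G$.
  have hzero : ∀ (u : Fin n → OrePoly σ δ) (l : Fin n),
      (∀ j, j ≤ l → ((u ᵥ* A) j).degree < (G j j).degree) → ∀ j, j ≤ l → (u ᵥ* A) j = 0 := by
    intro u l h j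
    induction j using WellFoundedLT.induction with
    | ind j ih =>
      exact fun hj => hmin j u (fun k hk => ih k hk (hk.le.trans hj)) (h j hj)
  -- Keeping the diagonal degrees of $G$ itself makes $SG$ reduced while the bounds from minimality
  -- still apply.
  obtain ⟨S, hdiag, hoff⟩ := exists_mul_of_le (G := G) (fun i j hj => hc i j hj) hmonG
    (e := fun i => (G i i).natDegree) (fun i => le_rfl)
  set U := S * Matrix.of c with hU
  have hSG : S * G = U * A := by rw [hGdef, hU, Matrix.mul_assoc]
  rw [hSG] at hdiag hoff
  have hdeg : ∀ i, ((U * A) i i).degree = (G i i).degree := fun i => by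
    rw [(hdiag i).1.degree_eq, (hdiag i).2, (hmonG i).degree_eq]
  have hH : IsHermite (U * A) :=
    { upper := fun i j hj => hzero (U i) j
        (fun k hk => hoff i k (hk.trans_lt hj).ne') j le_rfl
      monic := fun i => (hdiag i).1
      reduced := fun i j hij => by rw [hdeg]; exact hoff i j hij.ne }
  -- The remainders of the rows of $A$ lie in the row module and are reduced, hence zero; the
  -- quotients form the inverse of $U$.
  choose V hV using fun i => exists_reduction hH.upper hH.monic (A i)
  have hVA : Matrix.of V * (U * A) = A := by
    refine Matrix.ext fun i j => (sub_eq_zero.1 ?_).symm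
    have hrow : A i - V i ᵥ* (U * A) = (Pi.single i 1 - V i ᵥ* U) ᵥ* A := by
      rw [sub_vecMul, vecMul_vecMul, single_vecMul, one_smul]
      rfl
    have := hzero (Pi.single i 1 - V i ᵥ* U) j fun k _ => by
      rw [← hrow, ← hdeg]
      exact hV i k
    rw [← hrow] at this
    exact this j le_rfl
  have hVU : Matrix.of V * U = 1 :=
    eq_of_mul_eq_mul_right hA (by rw [Matrix.mul_assoc, hVA, Matrix.one_mul])
  have hUV : U * Matrix.of V = 1 :=
    eq_of_mul_eq_mul_right hH.eq_zero_of_vecMul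
      (by rw [Matrix.mul_assoc, hVA, Matrix.one_mul])
  exact ⟨U * A, hH, U, ⟨⟨U, Matrix.of V, hUV, hVU⟩, rfl⟩, rfl⟩

/-- A multiple `S H` of a Hermite form whose columns have the shape prescribed by the diagonal
degrees of `H` is `H` itself. -/
theorem IsHermite.mul_eq_self {H S : Matrix (Fin n) (Fin n) (OrePoly σ δ)} (hH : IsHermite H)
    (hmon : ∀ i, ((S * H) i i).Monic) (hdeg : ∀ i, ((S * H) i i).natDegree = (H i i).natDegree)
    (hoff : ∀ i j, i ≠ j → ((S * H) i j).degree < (H j j).degree) : S * H = H := by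
  have hS : S = 1 := by
    refine Matrix.ext fun i j => sub_eq_zero.1 (congrFun
      (hH.eq_zero_of_forall_reduced (s := fun k => S i k - (1 : Matrix _ _ _) i k) fun k => ?_) j)
    have hrow : ((fun k => S i k - (1 : Matrix _ _ (OrePoly σ δ)) i k) ᵥ* H) k =
        (S * H) i k - H i k := by
      have := congrFun (sub_vecMul H (S i) ((1 : Matrix (Fin n) (Fin n) (OrePoly σ δ)) i)) k
      refine this.trans ?_
      rw [Pi.sub_apply]
      conv_rhs => rw [← Matrix.one_mul H, ← Matrix.mul_assoc, Matrix.mul_one]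
      rfl
    rw [hrow]
    by_cases hik : i = k
    · subst hik
      rw [(hH.monic i).degree_eq]
      refine degree_lt_iff.2 fun m hm => ?_
      rw [coeff_sub]
      rcases hm.eq_or_lt with rfl | hm
      -- Two monic entries of equal degree: the leading terms cancel in the difference.
      · have h1 := hmon i
        rw [Monic, hdeg] at h1
        rw [h1, hH.monic i, sub_self]
      · rw [coeff_natDegree_lt _ m hm, coeff_natDegree_lt _ m (by rwa [hdeg]), sub_zero]
    · exact degree_sub_lt_of_lt (hoff i k hik) (hH.degree_off_diag_lt hik)
  rw [hS, Matrix.one_mul]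

/-- The row module of a Hermite form has no reduced row with a nonzero entry of too small
degree. -/
theorem IsHermite.not_degree_lt {H : Matrix (Fin n) (Fin n) (OrePoly σ δ)} (hH : IsHermite H)
    {s : Fin n → OrePoly σ δ} {l : Fin n}
    (h : ∀ j, j < l → ((s ᵥ* H) j).degree < (H j j).degree) (hl : (s ᵥ* H) l ≠ 0) :
    (H l l).degree ≤ ((s ᵥ* H) l).degree := by
  by_contra! hlt
  have hs := hH.eq_zero_of_reduced (s := s) (l := l) fun j hj => by
    rcases hj.eq_or_lt with rfl | hj
    · exact hlt
    · exact h j hj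
  refine hl (show ∑ k, s k * H k l = 0 from Finset.sum_eq_zero fun k _ => ?_)
  rcases le_or_gt k l with hk | hk
  · rw [hs k hk, zero_mul]
  · rw [hH.upper k l hk, mul_zero]

theorem IsHermiteFormOf.exists_mul_eq {H A : Matrix (Fin n) (Fin n) (OrePoly σ δ)}
    (h : IsHermiteFormOf H A) (T : Matrix (Fin n) (Fin n) (OrePoly σ δ)) :
    ∃ S : Matrix (Fin n) (Fin n) (OrePoly σ δ), S * H = T * A := by
  obtain ⟨-, U, ⟨U', rfl⟩, rfl⟩ := h
  exact ⟨T * (U'⁻¹ : (Matrix (Fin n) (Fin n) (OrePoly σ δ))ˣ), by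
    rw [Matrix.mul_assoc, ← Matrix.mul_assoc _ _ A, Units.inv_mul, Matrix.one_mul]⟩

theorem IsHermiteFormOf.exists_mul_eq_form {H H' A : Matrix (Fin n) (Fin n) (OrePoly σ δ)}
    (h : IsHermiteFormOf H A) (h' : IsHermiteFormOf H' A) :
    ∃ S : Matrix (Fin n) (Fin n) (OrePoly σ δ), S * H = H' := by
  obtain ⟨-, U, -, hU⟩ := h'
  rw [← hU]
  exact h.exists_mul_eq U

/-- Row $l$ of $H'$ lies in the row module of $H$, vanishes before column $l$ and is nonzero there,
so its entry cannot have degree below that of $H_{ll}$. By symmetry all diagonal degrees agree. -/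
theorem IsHermiteFormOf.degree_le {H H' A : Matrix (Fin n) (Fin n) (OrePoly σ δ)}
    (h : IsHermiteFormOf H A) (h' : IsHermiteFormOf H' A) (l : Fin n) :
    (H l l).degree ≤ (H' l l).degree := by
  obtain ⟨S, hS⟩ := h.exists_mul_eq_form h'
  have hrow : S l ᵥ* H = H' l := congrFun hS l
  rw [← hrow]
  refine h.1.not_degree_lt (fun j hj => ?_) ?_
  · rw [hrow, h'.1.upper l j hj, degree_zero, (h.1.monic j).degree_eq]
    exact WithBot.bot_lt_coe _
  · rw [hrow]
    exact (h'.1.monic l).ne_zero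

theorem IsHermiteFormOf.unique {H H' A : Matrix (Fin n) (Fin n) (OrePoly σ δ)}
    (h : IsHermiteFormOf H A) (h' : IsHermiteFormOf H' A) : H' = H := by
  have hdeg : ∀ l, (H l l).degree = (H' l l).degree := fun l =>
    le_antisymm (h.degree_le h' l) (h'.degree_le h l)
  obtain ⟨S, rfl⟩ := h.exists_mul_eq_form h'
  refine h.1.mul_eq_self h'.1.monic (fun i => ?_) fun i j hij => ?_
  · exact natDegree_eq_of_degree_eq (by rw [← hdeg, (h.1.monic i).degree_eq])
  · rw [hdeg]
    exact h'.1.degree_off_diag_lt hij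

/-! ### The linear system -/

theorem matrixOfCoeffs_injective {ρ : ℕ} :
    Function.Injective (matrixOfCoeffs σ δ (n := n) (ρ := ρ)) := fun s t h => by
  funext i j
  exact ofCoeffs_injective (congrFun (congrFun h i) j)

theorem matrixOfCoeffs_coeff {ρ : ℕ} {T : Matrix (Fin n) (Fin n) (OrePoly σ δ)}
    (hT : ∀ i j, (T i j).degree ≤ ρ) :
    matrixOfCoeffs σ δ (fun i j (k : Fin (ρ + 1)) => (T i j).coeff k) = T :=
  Matrix.ext fun i j => ofCoeffs_coeff (hT i j)

theorem isSolution_iff {A : Matrix (Fin n) (Fin n) (OrePoly σ δ)} {e : Fin n → ℕ} {ρ : ℕ}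
    {t : Fin n → Fin n → Fin (ρ + 1) → F} :
    IsSolution A e t ↔
      (∀ i, ((matrixOfCoeffs σ δ t * A) i i).Monic ∧
        ((matrixOfCoeffs σ δ t * A) i i).natDegree = e i) ∧
      ∀ i j, i ≠ j → ((matrixOfCoeffs σ δ t * A) i j).degree < e j := by
  refine ⟨fun h => ⟨fun i => monic_of_coeff (h.diag_degree i) (h.diag_monic i),
    fun i j hij => degree_lt_iff.2 fun k => h.off_diag i j k hij⟩, fun h => ⟨fun i => ?_,
    fun i k hk => ?_, fun i j k hij => degree_lt_iff.1 (h.2 i j hij) k⟩⟩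
  · rw [← (h.1 i).2]
    exact (h.1 i).1
  · exact coeff_natDegree_lt _ k (by rwa [(h.1 i).2])

/-- From $VH=A$ and the dominant diagonal of $H$ one gets $\deg V\le d$; the bound for inverses then
applies to $U$. -/
theorem degree_transform_le {H A U V : Matrix (Fin n) (Fin n) (OrePoly σ δ)}
    {d : ℕ} (hd : ∀ i j, (A i j).degree ≤ d) (hH : IsHermite H) (hVU : V * U = 1)
    (hUA : U * A = H) (i j : Fin n) : (U i j).degree ≤ (((n - 1) * d : ℕ) : WithBot ℕ) := by
  refine degree_inverse_le (fun i => hH.degree_le_of_vecMul fun j => ?_) hVU i j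
  have : V * H = A := by rw [← hUA, ← Matrix.mul_assoc, hVU, Matrix.one_mul]
  have hrow : V i ᵥ* H = A i := congrFun this i
  rw [hrow]
  exact (hd i j).trans (by exact_mod_cast Nat.le_add_right _ _)

theorem IsHermiteFormOf.exists_isSolution {H A : Matrix (Fin n) (Fin n) (OrePoly σ δ)} {d : ℕ}
    (hd : ∀ i j, (A i j).degree ≤ d) (h : IsHermiteFormOf H A) {e : Fin n → ℕ} {ρ : ℕ}
    (hρ : ∀ i, ((n : ℤ) - 1) * d + ((e i : ℤ) - (H i i).natDegree) ≤ ρ)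
    (he : ∀ i, (H i i).natDegree ≤ e i) :
    ∃ t : Fin n → Fin n → Fin (ρ + 1) → F, IsSolution A e t := by
  obtain ⟨hH, U, ⟨U', rfl⟩, hUA⟩ := h
  obtain ⟨S, hdiag, hoff⟩ := exists_mul_of_le hH.upper hH.monic he
  have hρ' : ∀ i, (n - 1) * d + e i ≤ ρ + (H i i).natDegree := fun i => by
    have h1 := hρ i
    have h2 : ((n - 1 : ℕ) : ℤ) = (n : ℤ) - 1 := by
      have := i.pos
      omega
    rw [← h2] at h1
    zify
    linarith
  have hoff' : ∀ i j, i ≠ j → ((S * H) i j).degree < e j := fun i j hij =>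
    (hoff i j hij).trans_le ((hH.monic j).degree_eq.trans_le (by exact_mod_cast he j))
  -- The natural subtraction is genuine: $e_i\ge h_i$ and the bound on $\varrho$ give
  -- $(n-1)d\le\varrho$ whenever a row exists.
  have hS : ∀ i j, (S i j).degree ≤ ((ρ - (n - 1) * d : ℕ) : WithBot ℕ) := fun i =>
    hH.degree_le_of_vecMul fun j => by
      have hle : ((S * H) i j).degree ≤ e j := by
        by_cases hij : i = j
        · subst hij
          rw [(hdiag i).1.degree_eq, (hdiag i).2]
        · exact (hoff' i j hij).le
      refine hle.trans ?_
      have := hρ' j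
      have := he j
      exact_mod_cast (by omega : e j ≤ ρ - (n - 1) * d + (H j j).natDegree)
  have hU := degree_transform_le hd hH U'.inv_mul hUA
  have hT : ∀ i j, ((S * (U' : Matrix (Fin n) (Fin n) (OrePoly σ δ))) i j).degree ≤ ρ := fun i j => by
    refine (degree_vecMul_le hU (hS i) j).trans ?_
    have := hρ' i
    have := he i
    exact_mod_cast (by omega : ρ - (n - 1) * d + (n - 1) * d ≤ ρ)
  refine ⟨fun i j k => ((S * (U' : Matrix (Fin n) (Fin n) (OrePoly σ δ))) i j).coeff k,
    isSolution_iff.2 ?_⟩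
  rw [matrixOfCoeffs_coeff hT, Matrix.mul_assoc, hUA]
  exact ⟨hdiag, hoff'⟩

/-- Row $l$ of $TA$ would be reduced before column $l$ and have a nonzero entry of degree $e_l<h_l$
there. -/
theorem IsHermiteFormOf.not_isSolution {H A : Matrix (Fin n) (Fin n) (OrePoly σ δ)}
    (h : IsHermiteFormOf H A) {e : Fin n → ℕ} {l : Fin n}
    (heq : ∀ i, i < l → e i = (H i i).natDegree) (hlt : e l < (H l l).natDegree) {ρ : ℕ}
    (t : Fin n → Fin n → Fin (ρ + 1) → F) : ¬ IsSolution A e t := fun ht => by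
  obtain ⟨hdiag, hoff⟩ := isSolution_iff.1 ht
  obtain ⟨S, hS⟩ := h.exists_mul_eq (matrixOfCoeffs σ δ t)
  rw [← hS] at hdiag hoff
  have := h.1.not_degree_lt (s := S l) (l := l) (fun j hj => by
    rw [(h.1.monic j).degree_eq, ← heq j hj]
    exact hoff l j hj.ne') (hdiag l).1.ne_zero
  have hle := ((h.1.monic l).degree_eq.symm.trans_le this).trans_eq (hdiag l).1.degree_eq
  rw [(hdiag l).2] at hle
  exact absurd hlt (not_lt.2 (by exact_mod_cast hle))

theorem IsHermiteFormOf.mul_eq_of_isSolution {H A : Matrix (Fin n) (Fin n) (OrePoly σ δ)}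
    (h : IsHermiteFormOf H A) {e : Fin n → ℕ} (heq : ∀ i, e i = (H i i).natDegree) {ρ : ℕ}
    {t : Fin n → Fin n → Fin (ρ + 1) → F} (ht : IsSolution A e t) :
    matrixOfCoeffs σ δ t * A = H := by
  obtain ⟨hdiag, hoff⟩ := isSolution_iff.1 ht
  obtain ⟨S, hS⟩ := h.exists_mul_eq (matrixOfCoeffs σ δ t)
  rw [← hS] at hdiag hoff ⊢
  refine h.1.mul_eq_self (fun i => (hdiag i).1) (fun i => (hdiag i).2.trans (heq i))
    fun i j hij => ?_
  rw [(h.1.monic j).degree_eq, ← heq j]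
  exact hoff i j hij

end OrePoly

theorem mainTheorem4 {F : Type u} [DivisionRing F] (σ : F ≃+* F) (δ : SigmaDerivation σ)
    (n : ℕ) (A : Matrix (Fin n) (Fin n) (OrePoly σ δ)) (hA : OrePoly.rowRank A = n)
    (d : ℕ) (hd : ∀ i j, (A i j).degree ≤ (d : WithBot ℕ)) :
    (∃! H, OrePoly.IsHermiteFormOf H A) ∧
    ∀ H, OrePoly.IsHermiteFormOf H A →
      ∀ h : Fin n → ℕ, (∀ i, h i = (H i i).natDegree) →
      ∀ (e : Fin n → ℕ) (ρ : ℕ),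
        (∀ i, ((n : ℤ) - 1) * (d : ℤ) + ((e i : ℤ) - (h i : ℤ)) ≤ (ρ : ℤ)) →
        ((∀ i, h i ≤ e i) →
          ∃ t : Fin n → Fin n → Fin (ρ + 1) → F, OrePoly.IsSolution A e t) ∧
        ((∃ l : Fin n, (∀ i, i < l → e i = h i) ∧ e l < h l) →
          ¬ ∃ t : Fin n → Fin n → Fin (ρ + 1) → F, OrePoly.IsSolution A e t) ∧
        ((∀ i, e i = h i) →
          (∃! t : Fin n → Fin n → Fin (ρ + 1) → F, OrePoly.IsSolution A e t) ∧
          ∀ t : Fin n → Fin n → Fin (ρ + 1) → F, OrePoly.IsSolution A e t →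
            OrePoly.matrixOfCoeffs σ δ t * A = H) := by
  have hker := OrePoly.vecMul_eq_zero_of_rowRank hA
  refine ⟨?_, fun H hH h hh e ρ hρ => ?_⟩
  · obtain ⟨H, hH⟩ := OrePoly.exists_isHermiteFormOf hd hker
    exact ⟨H, hH, fun H' hH' => hH.unique hH'⟩
  obtain rfl : h = fun i => (H i i).natDegree := funext hh
  refine ⟨hH.exists_isSolution hd hρ, ?_, fun he => ?_⟩
  · rintro ⟨l, heq, hlt⟩ ⟨t, ht⟩
    exact hH.not_isSolution heq hlt t ht
  · obtain ⟨t, ht⟩ := hH.exists_isSolution hd hρ fun i => (he i).ge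
    -- Both solutions satisfy $TA=H$; cancelling $A$ gives equal matrices, hence equal coefficients.
    refine ⟨⟨t, ht, fun t' ht' => OrePoly.matrixOfCoeffs_injective
      (OrePoly.eq_of_mul_eq_mul_right hker ?_)⟩, fun t ht => hH.mul_eq_of_isSolution he ht⟩
    rw [hH.mul_eq_of_isSolution he ht, hH.mul_eq_of_isSolution he ht']
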